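/- Let $a,b,n,k$ be positive integers with $b>4a$ and $b,n$ odd. Put $$A(x)=\binom{x+(b-2a)n}{(b-4a)n}\binom{x+(b-a)n}{(b-2a)n}\binom{x+bn}{bn},$$ a polynomial in $x$, and for $0<|z|<1$ put $$U(z)=-z^{-\frac{bn+1}{2}}\sum_{j=bn+1}^{\infty}A(-j)z^j,\quad V(z)=-z^{-\frac{bn+1}{2}}\sum_{j=(b-a)n+1}^{\infty}A'(-j)z^j,\quad W(z)=-z^{-\frac{bn+1}{2}}\sum_{j=(b-2a)n+1}^{\infty}A''(-j)z^j .$$ Let $x_k=\frac{k+1-\sqrt{2k+1}}{k}=\frac{\sqrt{2k+1}-1}{\sqrt{2k+1}+1}\in(0,1)$, and let $d_N=\operatorname{lcm}(1,2,\dots,N)$. Let $\Omega$ be the set of all $y\in[0,1)$ such that for every $x\in\mathbb R$ $$\bigl([x-2ay]-[x-(b-2a)y]-[(b-4a)y]\bigr)+\bigl([x-ay]-[x-(b-a)y]-[(b-2a)y]\bigr)+\bigl([x]-[x-by]-[by]\bigr)\ge 1,$$ where $[\cdot]$ is the integer part. Let $\Delta$ be the product of the (finitely many) primes $p>\sqrt{bn}$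 with $\{n/p\}\in\Omega$, where $\{\cdot\}$ is the fractional part, and let $\Delta_1$ be the product of the primes $p>(b-2a)n$ with $\{n/p\}\in\Omega$. Put $$R_{k,n}=\rho\Bigl(\tfrac{bn+1}{2}\Bigr),\quad S_{k,n}=\rho\Bigl(\tfrac{(b-2a)n+1}{2}\Bigr),\quad T_{k,n}=\rho\Bigl(\tfrac{(b-4a)n+1}{2}\Bigr),$$ where $\rho(e)=(k/2)^{-e}$ if $k$ is even and $\rho(e)=2^{\frac{3(b-2a)n+1}{2}}k^{-e}$ if $k$ is odd. Then $$R_{k,n}U(x_k)\in\mathbb Z,\qquad S_{k,n}\frac{d_{bn}}{\Delta}V(x_k)\sqrt{2k+1}\in\mathbb Z,\qquad T_{k,n}\,d_{(b-2a)n}\,\Delta_1\frac{d_{bn}}{\Delta}W(x_k)\in\mathbb Z .$$ Consequently, with $s=S_{k,n}\frac{d_{bn}}{\Delta}$ and $t=T_{k,n}d_{(b-2a)n}\Delta_1\frac{d_{bn}}{\Delta}$, the coefficients $$P_n=sU(x_k),\quad Q_n=-sV(x_k)\sqrt{2k+1},\quad X_n=tU(x_k),\quad Y_n=-tV(x_k)\sqrt{2k+1},\quad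 Z_n=-t(2k+1)W(x_k)$$ of the forms $P_n\alpha_k+Q_n$, $X_n\alpha_k+Y_n$, $X_n\alpha_k^2+Z_n$ in $\alpha_k=\sqrt{2k+1}\,\ln\frac{\sqrt{2k+1}-1}{\sqrt{2k+1}+1}$ are integers. -/

import Mathlib

namespace LogForms

open Polynomial

/-- The polynomial `A(x) = C(x+(b-2a)n, (b-4a)n) * C(x+(b-a)n, (b-2a)n) * C(x+bn, bn)`,
each binomial coefficient being written as a product of consecutive linear factors over a
factorial.  It is only used for `4 * a < b`, so the natural subtractions do not truncate. -/
noncomputable def polyA (a b n : ℕ) : ℝ[X] :=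
  (C (1 / (((b - 4 * a) * n).factorial : ℝ)) *
      ∏ i ∈ Finset.Icc (2 * a * n + 1) ((b - 2 * a) * n), (X + C (i : ℝ))) *
    (C (1 / (((b - 2 * a) * n).factorial : ℝ)) *
      ∏ i ∈ Finset.Icc (a * n + 1) ((b - a) * n), (X + C (i : ℝ))) *
    (C (1 / ((b * n).factorial : ℝ)) *
      ∏ i ∈ Finset.Icc 1 (b * n), (X + C (i : ℝ)))

/-- The series `∑_{j ≥ N} P(-j) z^j`. -/
noncomputable def tailSeries (P : ℝ[X]) (N : ℕ) (z : ℝ) : ℝ :=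
  ∑' j : ℕ, P.eval (-((N + j : ℕ) : ℝ)) * z ^ (N + j)

/-- The series converges for `|z| < 1`. -/
theorem summable_tailSeries (P : ℝ[X]) (N : ℕ) {z : ℝ} (hz : |z| < 1) :
    Summable fun j : ℕ => P.eval (-((N + j : ℕ) : ℝ)) * z ^ (N + j) := by
  have key : Summable fun j : ℕ => P.eval (-(j : ℝ)) * z ^ j := by
    induction P using Polynomial.induction_on' with
    | add p q hp hq =>
      refine (hp.add hq).congr fun j => ?_
      simp [add_mul]
    | monomial m c =>
      have h := (summable_pow_mul_geometric_of_norm_lt_one (R := ℝ) m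
        (r := z) (by simpa using hz)).mul_left (c * (-1) ^ m)
      refine h.congr fun j => ?_
      rw [eval_monomial, neg_pow (j : ℝ) m]
      ring
  have h := (summable_nat_add_iff N).2 key
  refine h.congr fun j => ?_
  rw [add_comm j N]

/-- `U(z) = - z^{-(bn+1)/2} ∑_{j ≥ bn+1} A(-j) z^j`  (`b`, `n` odd). -/
noncomputable def U (a b n : ℕ) (z : ℝ) : ℝ :=
  -(z ^ (-(((b * n + 1) / 2 : ℕ) : ℤ))) * tailSeries (polyA a b n) (b * n + 1) z

/-- `V(z) = - z^{-(bn+1)/2} ∑_{j ≥ (b-a)n+1} A'(-j) z^j`. -/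
noncomputable def V (a b n : ℕ) (z : ℝ) : ℝ :=
  -(z ^ (-(((b * n + 1) / 2 : ℕ) : ℤ))) *
    tailSeries (derivative (polyA a b n)) ((b - a) * n + 1) z

/-- `W(z) = - z^{-(bn+1)/2} ∑_{j ≥ (b-2a)n+1} A''(-j) z^j`. -/
noncomputable def W (a b n : ℕ) (z : ℝ) : ℝ :=
  -(z ^ (-(((b * n + 1) / 2 : ℕ) : ℤ))) *
    tailSeries (derivative (derivative (polyA a b n))) ((b - 2 * a) * n + 1) z

/-- The point `x_k = (k + 1 - √(2k+1)) / k`. -/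
noncomputable def xk (k : ℕ) : ℝ := ((k : ℝ) + 1 - √(2 * (k : ℝ) + 1)) / k

/-- For `k ≥ 1` the point `x_k` lies in the domain of convergence and is nonzero. -/
theorem xk_mem_Ioo {k : ℕ} (hk : 1 ≤ k) : xk k ∈ Set.Ioo (0 : ℝ) 1 := by
  have hk' : (1 : ℝ) ≤ k := by exact_mod_cast hk
  have h1 : √(2 * (k : ℝ) + 1) < k + 1 := by
    rw [Real.sqrt_lt' (by linarith)]
    nlinarith
  have h2 : 1 < √(2 * (k : ℝ) + 1) := by
    rw [Real.lt_sqrt (by norm_num)]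
    linarith
  have hk0 : (0 : ℝ) < k := by linarith
  refine ⟨div_pos (by linarith) hk0, ?_⟩
  unfold xk
  rw [div_lt_one hk0]
  linarith

/-- The set `Ω ⊆ [0, 1)`. -/
def Omega (a b : ℕ) : Set ℝ :=
  {y : ℝ | 0 ≤ y ∧ y < 1 ∧ ∀ x : ℝ,
    1 ≤ (⌊x - 2 * a * y⌋ - ⌊x - (b - 2 * a) * y⌋ - ⌊(b - 4 * a) * y⌋) +
        (⌊x - a * y⌋ - ⌊x - (b - a) * y⌋ - ⌊(b - 2 * a) * y⌋) +
        (⌊x⌋ - ⌊x - b * y⌋ - ⌊b * y⌋)}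

/-- The primes `p > √(bn)` with `{n / p} ∈ Ω`. -/
def DeltaPrimes (a b n : ℕ) : Set ℕ :=
  {p : ℕ | p.Prime ∧ √((b : ℝ) * n) < p ∧ Int.fract ((n : ℝ) / p) ∈ Omega a b}

/-- The primes `p > (b-2a)n` with `{n / p} ∈ Ω`. -/
def Delta1Primes (a b n : ℕ) : Set ℕ :=
  {p : ℕ | p.Prime ∧ (b - 2 * a) * n < p ∧ Int.fract ((n : ℝ) / p) ∈ Omega a b}

theorem le_of_fract_mem_Omega {a b n p : ℕ} (hab : 4 * a < b)
    (h : Int.fract ((n : ℝ) / p) ∈ Omega a b) : p ≤ b * n := by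
  by_contra! hp
  have hp0 : (0 : ℝ) < p := by exact_mod_cast (Nat.zero_le _).trans_lt hp
  have hpr : (b : ℝ) * n < p := by exact_mod_cast hp
  have hb : (4 : ℝ) * a < b := by exact_mod_cast hab
  have hb1 : (1 : ℝ) ≤ b := by
    have : 1 ≤ b := by omega
    exact_mod_cast this
  have ha : (0 : ℝ) ≤ a := Nat.cast_nonneg a
  have hn : (0 : ℝ) ≤ n := Nat.cast_nonneg n
  have hy0 : (0 : ℝ) ≤ (n : ℝ) / p := by positivity
  have hby : (b : ℝ) * ((n : ℝ) / p) < 1 := by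
    rw [← mul_div_assoc, div_lt_one hp0]
    exact hpr
  have hy1 : (n : ℝ) / p < 1 := by nlinarith
  rw [Int.fract_eq_self.2 ⟨hy0, hy1⟩] at h
  obtain ⟨-, -, h⟩ := h
  generalize (n : ℝ) / p = y at *
  have hay : 0 ≤ (a : ℝ) * y := by positivity
  have hbay : (4 : ℝ) * a * y ≤ b * y := mul_le_mul_of_nonneg_right hb.le hy0
  have fl : ∀ t : ℝ, 0 ≤ t → t < 1 → ⌊t⌋ = 0 := fun t h0 h1 =>
    Int.floor_eq_zero_iff.2 ⟨h0, h1⟩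
  have := h (b * y)
  rw [fl (b * y - 2 * a * y) (by linarith) (by linarith),
    fl (b * y - (b - 2 * a) * y) (by linarith) (by linarith),
    fl ((b - 4 * a) * y) (by linarith) (by linarith),
    fl (b * y - a * y) (by linarith) (by linarith),
    fl (b * y - (b - a) * y) (by linarith) (by linarith),
    fl ((b - 2 * a) * y) (by linarith) (by linarith),
    fl (b * y) (by linarith) (by linarith),
    fl (b * y - b * y) (by linarith) (by linarith)] at this
  norm_num at this

theorem finite_DeltaPrimes {a b : ℕ} (n : ℕ) (hab : 4 * a < b) :
    (DeltaPrimes a b n).Finite :=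
  (Set.finite_Iic (b * n)).subset fun _ hp => le_of_fract_mem_Omega hab hp.2.2

theorem finite_Delta1Primes {a b : ℕ} (n : ℕ) (hab : 4 * a < b) :
    (Delta1Primes a b n).Finite :=
  (Set.finite_Iic (b * n)).subset fun _ hp => le_of_fract_mem_Omega hab hp.2.2

/-- `Δ`: the product of the primes `p > √(bn)` with `{n / p} ∈ Ω`
(a finite product, by `finite_DeltaPrimes`). -/
noncomputable def Delta (a b n : ℕ) : ℕ := ∏ᶠ p ∈ DeltaPrimes a b n, p

/-- `Δ₁`: the product of the primes `p > (b-2a)n` with `{n / p} ∈ Ω`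
(a finite product, by `finite_Delta1Primes`). -/
noncomputable def Delta1 (a b n : ℕ) : ℕ := ∏ᶠ p ∈ Delta1Primes a b n, p

/-- `d N = lcm(1, 2, …, N)`. -/
def d (N : ℕ) : ℕ := (Finset.Icc 1 N).lcm id

/-- `m ^ (-e)` if `k = 2m`, and `2 ^ ((3(b-2a)n+1)/2) * k ^ (-e)` if `k` is odd. -/
noncomputable def factor (a b n k e : ℕ) : ℝ :=
  if Even k then ((k / 2 : ℕ) : ℝ) ^ (-(e : ℤ))
  else 2 ^ ((3 * (b - 2 * a) * n + 1) / 2) * (k : ℝ) ^ (-(e : ℤ))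

/-- `R_{k,n}`: exponent `(bn+1)/2`. -/
noncomputable def R (a b n k : ℕ) : ℝ := factor a b n k ((b * n + 1) / 2)

/-- `S_{k,n}`: exponent `((b-2a)n+1)/2`. -/
noncomputable def S (a b n k : ℕ) : ℝ := factor a b n k (((b - 2 * a) * n + 1) / 2)

/-- `T_{k,n}`: exponent `((b-4a)n+1)/2`. -/
noncomputable def T (a b n k : ℕ) : ℝ := factor a b n k (((b - 4 * a) * n + 1) / 2)

/-- The multiplier `S_{k,n} d_{bn} / Δ`. -/
noncomputable def multS (a b n k : ℕ) : ℝ :=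
  S a b n k * ((d (b * n) : ℝ) / (Delta a b n : ℝ))

/-- The multiplier `T_{k,n} d_{(b-2a)n} Δ₁ d_{bn} / Δ`. -/
noncomputable def multT (a b n k : ℕ) : ℝ :=
  T a b n k * (d ((b - 2 * a) * n) : ℝ) * (Delta1 a b n : ℝ) *
    ((d (b * n) : ℝ) / (Delta a b n : ℝ))

/-- `P_n`, the coefficient of `α_k` in the linear form `E_n = P_n α_k + Q_n`. -/
noncomputable def coeffP (a b n k : ℕ) : ℝ := multS a b n k * U a b n (xk k)

/-- `Q_n`, the constant term of `E_n = P_n α_k + Q_n`. -/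
noncomputable def coeffQ (a b n k : ℕ) : ℝ :=
  -(multS a b n k * V a b n (xk k) * √(2 * (k : ℝ) + 1))

/-- `X_n`, the leading coefficient of `F_n = X_n α_k + Y_n` and `G_n = X_n α_k² + Z_n`. -/
noncomputable def coeffX (a b n k : ℕ) : ℝ := multT a b n k * U a b n (xk k)

/-- `Y_n`, the constant term of `F_n = X_n α_k + Y_n`. -/
noncomputable def coeffY (a b n k : ℕ) : ℝ :=
  -(multT a b n k * V a b n (xk k) * √(2 * (k : ℝ) + 1))

/-- `Z_n`, the constant term of `G_n = X_n α_k² + Z_n`. -/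
noncomputable def coeffZ (a b n k : ℕ) : ℝ :=
  -(multT a b n k * (2 * (k : ℝ) + 1) * W a b n (xk k))

end LogForms

/-! Put c = (bn+1)/2. The three blocks of linear factors of A have odd length and the common centre
-c, so A is odd about -c, A' is even and A'' is odd (`polyA_reflect`, `eval_derivative_reflect`). If
P is one of them and M its multiplier, then w ↦ M·P(-c-w) is an odd or even polynomial. It vanishes
for |w| < e₀, where e₀ is c, c-an or c-2an, because the blocks overlap in simple, double and triple
zeros. If this polynomial is integer-valued, it is an integral combination of central binomial
polynomials of index e ≥ e₀ (`exists_int_combination`). Their generating functions are (z/(1-z)²)^e,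
times (1+z)/(1-z) in the even case. At z = x_k these two quantities are k/2 and √(2k+1). Hence the
series are integral combinations of powers (k/2)^e with e₀ ≤ e ≤ (3(b-2a)n+1)/2, up to one factor
√(2k+1) for V, and `factor` clears the denominators. It remains to see that M·P is integral at
integers, with M = 1, d_{bn}/Δ and d_{(b-2a)n}Δ₁d_{bn}/Δ. Each derivative deletes one linear factor
from the product. For every prime power q the surviving multiples of q are compared with Legendre's
count for the factorials in the denominator (`prod_factorial_dvd_mul_prod`). A deletion costs at
most one per level q, which the lcm's repay. For primes in Δ, the condition defining Ω supplies one
spare multiple at level q = p, so dividing by Δ is allowed. -/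

namespace LogForms

open Polynomial

/-! ### Central binomial polynomials as an integral basis -/

/-- The odd central basis polynomial, equal to `C(w + e - 1, 2e - 1)` at `w`. -/
noncomputable def oddBasis (e : ℕ) : ℝ[X] :=
  C (1 / ((2 * e - 1).factorial : ℝ)) * (descPochhammer ℝ (2 * e - 1)).comp (X + C ((e : ℝ) - 1))

/-- The even central basis polynomial, equal to `C(w + e, 2e) + C(w + e - 1, 2e)` at `w`. -/
noncomputable def evenBasis (e : ℕ) : ℝ[X] := C (1 / (e : ℝ)) * X * oddBasis e

theorem oddBasis_eval_nat {e : ℕ} (he : 1 ≤ e) (w : ℕ) :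
    (oddBasis e).eval (w : ℝ) = ((w + e - 1).choose (2 * e - 1) : ℕ) := by
  have h : (w : ℝ) + ((e : ℝ) - 1) = ((w + e - 1 : ℕ) : ℝ) := by
    rw [Nat.cast_sub (by omega)]; push_cast; ring
  have hf : ((2 * e - 1).factorial : ℝ) ≠ 0 := by exact_mod_cast Nat.factorial_ne_zero _
  simp only [oddBasis, eval_mul, eval_C, eval_comp, eval_add, eval_X]
  rw [h, descPochhammer_eval_eq_descFactorial, Nat.descFactorial_eq_factorial_mul_choose]
  push_cast
  field_simp

theorem oddBasis_natDegree (e : ℕ) : (oddBasis e).natDegree ≤ 2 * e - 1 := by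
  refine (natDegree_C_mul_le _ _).trans (natDegree_comp_le.trans ?_)
  rw [descPochhammer_natDegree, natDegree_X_add_C, mul_one]

/-- The roots are the 2e-1 integers of absolute value less than e, a symmetric set of odd size. -/
theorem oddBasis_eval_neg {e : ℕ} (he : 1 ≤ e) (x : ℝ) :
    (oddBasis e).eval (-x) = -(oddBasis e).eval x := by
  simp only [oddBasis, eval_mul, eval_C, eval_comp, eval_add, eval_X]
  have h1 : -x + ((e : ℝ) - 1) - ((2 * e - 1 : ℕ) : ℝ) + 1 = -(x + ((e : ℝ) - 1)) := by
    rw [Nat.cast_sub (by omega)]; push_cast; ring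
  have h2 : Odd (2 * e - 1) := ⟨e - 1, by omega⟩
  rw [descPochhammer_eval_eq_ascPochhammer, h1, ascPochhammer_eval_neg_eq_descPochhammer,
    h2.neg_one_pow]
  ring

theorem evenBasis_eval_nat {e : ℕ} (he : 1 ≤ e) (w : ℕ) :
    (evenBasis e).eval (w : ℝ) =
      ((w + e).choose (2 * e) : ℕ) + ((w + e - 1).choose (2 * e) : ℕ) := by
  have he0 : (e : ℝ) ≠ 0 := by exact_mod_cast (by omega : e ≠ 0)
  rw [evenBasis, eval_mul, oddBasis_eval_nat he]
  simp only [eval_mul, eval_C, eval_X]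
  obtain ⟨f, rfl⟩ : ∃ f, e = f + 1 := ⟨e - 1, by omega⟩
  have h1 : w + (f + 1) - 1 = w + f := by omega
  have h2 : 2 * (f + 1) - 1 = 2 * f + 1 := by omega
  have h3 : 2 * (f + 1) = 2 * f + 1 + 1 := by omega
  rw [h1, h2, h3, ← add_assoc w f 1, Nat.choose_succ_succ]
  have key := Nat.choose_succ_right_eq (w + f) (2 * f + 1)
  -- The recurrence `key` contains a natural subtraction, which can be cast to ℝ only when it does
  -- not truncate. In the other case all binomials vanish.
  rcases le_or_gt (2 * f + 1) (w + f) with hle | hlt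
  · have key' : ((w + f).choose (2 * f + 1 + 1) : ℝ) * (2 * f + 1 + 1) =
        (w + f).choose (2 * f + 1) * ((w : ℝ) + f - (2 * f + 1)) := by
      have := congrArg (Nat.cast (R := ℝ)) key
      rw [Nat.cast_mul, Nat.cast_mul, Nat.cast_sub hle] at this
      push_cast at this
      linarith
    push_cast at he0 ⊢
    field_simp
    linarith
  · rw [Nat.choose_eq_zero_of_lt hlt, Nat.choose_eq_zero_of_lt (by omega : w + f < 2 * f + 1 + 1)]
    simp

theorem evenBasis_natDegree {e : ℕ} (he : 1 ≤ e) : (evenBasis e).natDegree ≤ 2 * e := by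
  refine natDegree_mul_le.trans ?_
  have h1 := oddBasis_natDegree e
  have h2 : (C (1 / (e : ℝ)) * X : ℝ[X]).natDegree ≤ 1 :=
    (natDegree_C_mul_le _ _).trans natDegree_X_le
  omega

theorem evenBasis_eval_neg {e : ℕ} (he : 1 ≤ e) (x : ℝ) :
    (evenBasis e).eval (-x) = (evenBasis e).eval x := by
  simp only [evenBasis, eval_mul, eval_C, eval_X, oddBasis_eval_neg he]
  ring

/-- A polynomial with the parity `ε`, integral at the naturals and vanishing for `|w| < e₀`, is an
integral combination of any family of polynomials `p e`, `e ≥ e₀`, of the same parity with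
`p e` vanishing for `|w| < e` and `p e (e) = 1`. -/
theorem exists_int_combination (ε : ℝ) (p : ℕ → ℝ[X])
    (hdeg : ∀ e, 1 ≤ e → (p e).natDegree ≤ 2 * e)
    (hpar : ∀ e, 1 ≤ e → ∀ x, (p e).eval (-x) = ε * (p e).eval x)
    (hzero : ∀ e, 1 ≤ e → ∀ w : ℕ, w < e → (p e).eval (w : ℝ) = 0)
    (hone : ∀ e, 1 ≤ e → (p e).eval (e : ℝ) = 1)
    (hint : ∀ e, 1 ≤ e → ∀ w : ℕ, ∃ m : ℤ, (p e).eval (w : ℝ) = m)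
    (r : ℕ) : ∀ (e₀ : ℕ) (β : ℝ[X]), 1 ≤ e₀ → β.natDegree + 2 ≤ 2 * (e₀ + r) →
      (∀ x, β.eval (-x) = ε * β.eval x) → (∀ w : ℕ, w < e₀ → β.eval (w : ℝ) = 0) →
      (∀ w : ℕ, ∃ m : ℤ, β.eval (w : ℝ) = m) →
      ∃ a : ℕ → ℤ, β = ∑ i ∈ Finset.range r, C (a i : ℝ) * p (e₀ + i) := by
  induction r with
  | zero =>
    intro e₀ β he₀ hd hβpar hβzero hβint
    refine ⟨0, ?_⟩
    rw [Finset.sum_range_zero]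
    -- By parity β vanishes at all 2e₀-1 integers with |w| < e₀, one more than its degree allows.
    refine eq_zero_of_natDegree_lt_card_of_eval_eq_zero' β
      ((Finset.Ioo (-(e₀ : ℤ)) e₀).map ⟨((↑) : ℤ → ℝ), Int.cast_injective⟩) ?_ ?_
    · intro x hx
      obtain ⟨w, hw, rfl⟩ := Finset.mem_map.1 hx
      rw [Finset.mem_Ioo] at hw
      obtain ⟨v, rfl | rfl⟩ := Int.eq_nat_or_neg w
      · simpa using hβzero v (by omega)
      · simp only [Function.Embedding.coeFn_mk, Int.cast_neg, Int.cast_natCast]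
        rw [hβpar, hβzero v (by omega), mul_zero]
    · rw [Finset.card_map, Int.card_Ioo]
      omega
  | succ r ih =>
    intro e₀ β he₀ hd hβpar hβzero hβint
    obtain ⟨m, hm⟩ := hβint e₀
    -- Subtracting β(e₀)·`p e₀` kills the value at e₀ and keeps parity and integrality, so the zero
    -- set grows by one step on each side.
    refine (ih (e₀ + 1) (β - C (m : ℝ) * p e₀) (by omega) ?_ ?_ ?_ ?_).elim fun a ha => ?_
    rotate_right
    · refine ⟨fun i => if i = 0 then m else a (i - 1), ?_⟩
      rw [Finset.sum_range_succ']
      rw [sub_eq_iff_eq_add] at ha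
      rw [ha]
      simp [add_assoc, add_comm 1]
    · have h1 := natDegree_sub_le β (C (m : ℝ) * p e₀)
      have h2 := (natDegree_C_mul_le (m : ℝ) (p e₀)).trans (hdeg e₀ he₀)
      rcases le_max_iff.1 h1 with h | h <;> omega
    · intro x
      simp only [eval_sub, eval_mul, eval_C, hβpar, hpar e₀ he₀]
      ring
    · intro w hw
      simp only [eval_sub, eval_mul, eval_C]
      rcases Nat.lt_succ_iff_lt_or_eq.1 hw with h | rfl
      · rw [hβzero w h, hzero e₀ he₀ w h]; ring
      · rw [hm, hone w he₀]; ring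
    · intro w
      obtain ⟨m₁, h₁⟩ := hβint w
      obtain ⟨m₂, h₂⟩ := hint e₀ he₀ w
      refine ⟨m₁ - m * m₂, ?_⟩
      simp only [eval_sub, eval_mul, eval_C, h₁, h₂]
      push_cast; ring

theorem exists_int_combination_odd {r e₀ : ℕ} {β : ℝ[X]} (he₀ : 1 ≤ e₀)
    (hd : β.natDegree + 2 ≤ 2 * (e₀ + r)) (hpar : ∀ x, β.eval (-x) = -β.eval x)
    (hzero : ∀ w : ℕ, w < e₀ → β.eval (w : ℝ) = 0)
    (hint : ∀ w : ℕ, ∃ m : ℤ, β.eval (w : ℝ) = m) :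
    ∃ a : ℕ → ℤ, β = ∑ i ∈ Finset.range r, C (a i : ℝ) * oddBasis (e₀ + i) := by
  refine exists_int_combination (-1) oddBasis (fun e _ => (oddBasis_natDegree e).trans (by omega))
    (fun e he x => by rw [oddBasis_eval_neg he]; ring) (fun e he w hw => ?_) (fun e he => ?_)
    (fun e he w => ⟨_, by rw [oddBasis_eval_nat he]; exact (Int.cast_natCast _).symm⟩)
    r e₀ β he₀ hd (fun x => by rw [hpar]; ring) hzero hint
  · rw [oddBasis_eval_nat he, Nat.choose_eq_zero_of_lt (by omega), Nat.cast_zero]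
  · rw [oddBasis_eval_nat he, (by omega : e + e - 1 = 2 * e - 1), Nat.choose_self, Nat.cast_one]

theorem exists_int_combination_even {r e₀ : ℕ} {β : ℝ[X]} (he₀ : 1 ≤ e₀)
    (hd : β.natDegree + 2 ≤ 2 * (e₀ + r)) (hpar : ∀ x, β.eval (-x) = β.eval x)
    (hzero : ∀ w : ℕ, w < e₀ → β.eval (w : ℝ) = 0)
    (hint : ∀ w : ℕ, ∃ m : ℤ, β.eval (w : ℝ) = m) :
    ∃ a : ℕ → ℤ, β = ∑ i ∈ Finset.range r, C (a i : ℝ) * evenBasis (e₀ + i) := by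
  refine exists_int_combination 1 evenBasis (fun e he => evenBasis_natDegree he)
    (fun e he x => by rw [evenBasis_eval_neg he]; ring) (fun e he w hw => ?_) (fun e he => ?_)
    (fun e he w => ⟨(w + e).choose (2 * e) + (w + e - 1).choose (2 * e), by
      rw [evenBasis_eval_nat he]; push_cast; rfl⟩)
    r e₀ β he₀ hd (fun x => by rw [hpar]; ring) hzero hint
  · rw [evenBasis_eval_nat he, Nat.choose_eq_zero_of_lt (by omega),
      Nat.choose_eq_zero_of_lt (by omega)]
    simp
  · rw [evenBasis_eval_nat he, (by omega : e + e = 2 * e), Nat.choose_self,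
      Nat.choose_eq_zero_of_lt (by omega)]
    simp

/-! ### Generating functions and recentred tail series -/

theorem hasSum_choose_mul_pow (j s : ℕ) {z : ℝ} (hz : |z| < 1) :
    HasSum (fun w : ℕ => ((w + j).choose (j + s) : ℝ) * z ^ w) (z ^ s / (1 - z) ^ (j + s + 1)) := by
  rw [← hasSum_nat_add_iff' s]
  have h0 : ∑ i ∈ Finset.range s, ((i + j).choose (j + s) : ℝ) * z ^ i = 0 :=
    Finset.sum_eq_zero fun i hi => by
      rw [Nat.choose_eq_zero_of_lt (by rw [Finset.mem_range] at hi; omega)]; simp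
  rw [h0, sub_zero]
  have h := (hasSum_choose_mul_geometric_of_norm_lt_one (j + s) (r := z)
    (by simpa using hz)).mul_left (z ^ s)
  rw [mul_one_div] at h
  refine h.congr_fun fun n => ?_
  rw [pow_add, add_assoc n s j, add_comm s j]
  ring

theorem hasSum_oddBasis {e : ℕ} (he : 1 ≤ e) {z : ℝ} (hz : |z| < 1) :
    HasSum (fun w : ℕ => (oddBasis e).eval (w : ℝ) * z ^ w) ((z / (1 - z) ^ 2) ^ e) := by
  have h := hasSum_choose_mul_pow (e - 1) e hz
  rw [(by omega : e - 1 + e + 1 = 2 * e), pow_mul, ← div_pow] at h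
  refine h.congr_fun fun w => ?_
  rw [oddBasis_eval_nat he, (by omega : w + e - 1 = w + (e - 1)),
    (by omega : 2 * e - 1 = e - 1 + e)]

/-- The two binomials contribute z^e and z^(e+1) over the same denominator (1-z)^(2e+1), whence the
factor 1+z. -/
theorem hasSum_evenBasis {e : ℕ} (he : 1 ≤ e) {z : ℝ} (hz : |z| < 1) :
    HasSum (fun w : ℕ => (evenBasis e).eval (w : ℝ) * z ^ w)
      ((z / (1 - z) ^ 2) ^ e * ((1 + z) / (1 - z))) := by
  have h := (hasSum_choose_mul_pow e e hz).add (hasSum_choose_mul_pow (e - 1) (e + 1) hz)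
  rw [(by omega : e - 1 + (e + 1) + 1 = e + e + 1)] at h
  have hz1 : 1 - z ≠ 0 := by have := (abs_lt.1 hz).2; linarith
  have hs : z ^ e / (1 - z) ^ (e + e + 1) + z ^ (e + 1) / (1 - z) ^ (e + e + 1) =
      (z / (1 - z) ^ 2) ^ e * ((1 + z) / (1 - z)) := by
    rw [div_pow, ← pow_mul, two_mul, pow_succ, pow_succ]
    field_simp
  rw [hs] at h
  refine h.congr_fun fun w => ?_
  rw [evenBasis_eval_nat he, (by omega : w + e - 1 = w + (e - 1)),
    (by omega : e - 1 + (e + 1) = e + e), two_mul, add_mul]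

theorem hasSum_combination {p : ℕ → ℝ[X]} {z : ℝ} {g : ℕ → ℝ} {r e₀ : ℕ} {β : ℝ[X]} {a : ℕ → ℤ}
    (he₀ : 1 ≤ e₀)
    (hp : ∀ e, 1 ≤ e → HasSum (fun w : ℕ => (p e).eval (w : ℝ) * z ^ w) (g e))
    (hβ : β = ∑ i ∈ Finset.range r, C (a i : ℝ) * p (e₀ + i)) :
    HasSum (fun w : ℕ => β.eval (w : ℝ) * z ^ w) (∑ i ∈ Finset.range r, a i * g (e₀ + i)) := by
  have h := hasSum_sum (s := Finset.range r)
    (fun i _ => (hp (e₀ + i) (by omega)).mul_left (a i : ℝ))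
  refine h.congr_fun fun w => ?_
  rw [hβ, eval_finsetSum, Finset.sum_mul]
  refine Finset.sum_congr rfl fun i _ => ?_
  rw [eval_mul, eval_C, mul_assoc]

/-- The tail series of `P`, recentred at `-c`. -/
theorem tailSeries_eq_of_hasSum {P β : ℝ[X]} {M z s : ℝ} {c e₀ : ℕ} (hz : z ≠ 0)
    (hβ : ∀ x, β.eval x = M * P.eval (-c - x)) (hzero : ∀ w : ℕ, w < e₀ → β.eval (w : ℝ) = 0)
    (h : HasSum (fun w : ℕ => β.eval (w : ℝ) * z ^ w) s) :
    M * (-(z ^ (-(c : ℤ))) * tailSeries P (c + e₀) z) = -s := by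
  rw [← hasSum_nat_add_iff' e₀] at h
  rw [Finset.sum_eq_zero fun i hi => by rw [hzero i (Finset.mem_range.1 hi), zero_mul],
    sub_zero] at h
  rw [← h.tsum_eq, tailSeries, ← mul_assoc, ← tsum_mul_left, ← tsum_neg]
  refine tsum_congr fun j => ?_
  rw [hβ, zpow_neg, zpow_natCast, (by omega : c + e₀ + j = c + (j + e₀)), pow_add]
  have : -((c + (j + e₀) : ℕ) : ℝ) = -(c : ℝ) - ((j + e₀ : ℕ) : ℝ) := by push_cast; ring
  rw [this]
  field_simp

theorem natDegree_recentred {P : ℝ[X]} (M : ℝ) (c : ℕ) :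
    (C M * P.comp (-X - C (c : ℝ))).natDegree ≤ P.natDegree := by
  refine (natDegree_C_mul_le _ _).trans (natDegree_comp_le.trans ?_)
  have : (-X - C (c : ℝ) : ℝ[X]).natDegree ≤ 1 := by
    rw [natDegree_sub_C, natDegree_neg]
    exact natDegree_X_le
  nlinarith

theorem tailSeries_odd {P : ℝ[X]} {M z : ℝ} {c e₀ r : ℕ} (hz0 : z ≠ 0) (hz : |z| < 1)
    (he₀ : 1 ≤ e₀) (hd : P.natDegree + 2 ≤ 2 * (e₀ + r))
    (hpar : ∀ x, P.eval (-(2 * (c : ℝ)) - x) = -P.eval x)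
    (hzero : ∀ w : ℕ, w < e₀ → P.eval (-(c : ℝ) - w) = 0)
    (hint : ∀ m : ℤ, ∃ l : ℤ, M * P.eval (m : ℝ) = l) :
    ∃ a : ℕ → ℤ, M * (-(z ^ (-(c : ℤ))) * tailSeries P (c + e₀) z) =
      ∑ i ∈ Finset.range r, a i * (z / (1 - z) ^ 2) ^ (e₀ + i) := by
  set β : ℝ[X] := C M * P.comp (-X - C (c : ℝ)) with hβdef
  have hβ : ∀ x, β.eval x = M * P.eval (-c - x) := fun x => by
    simp only [hβdef, eval_mul, eval_C, eval_comp, eval_sub, eval_neg, eval_X]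
    ring_nf
  have hβ0 : ∀ w : ℕ, w < e₀ → β.eval (w : ℝ) = 0 := fun w hw => by rw [hβ, hzero w hw, mul_zero]
  obtain ⟨a, ha⟩ := exists_int_combination_odd (β := β) he₀
    (hd.trans' (Nat.add_le_add_right (natDegree_recentred M c) 2))
    (fun x => by rw [hβ, hβ, ← mul_neg, ← hpar]; ring_nf) hβ0 (fun w => by
      obtain ⟨l, hl⟩ := hint (-c - w)
      exact ⟨l, by rw [hβ, ← hl]; push_cast; ring⟩)
  -- The sign comes from the minus in front of the tail series.
  refine ⟨fun i => -a i, ?_⟩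
  rw [tailSeries_eq_of_hasSum hz0 hβ hβ0
    (hasSum_combination he₀ (fun e he => hasSum_oddBasis he hz) ha), ← Finset.sum_neg_distrib]
  refine Finset.sum_congr rfl fun i _ => ?_
  push_cast; ring

theorem tailSeries_even {P : ℝ[X]} {M z : ℝ} {c e₀ r : ℕ} (hz0 : z ≠ 0) (hz : |z| < 1)
    (he₀ : 1 ≤ e₀) (hd : P.natDegree + 2 ≤ 2 * (e₀ + r))
    (hpar : ∀ x, P.eval (-(2 * (c : ℝ)) - x) = P.eval x)
    (hzero : ∀ w : ℕ, w < e₀ → P.eval (-(c : ℝ) - w) = 0)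
    (hint : ∀ m : ℤ, ∃ l : ℤ, M * P.eval (m : ℝ) = l) :
    ∃ a : ℕ → ℤ, M * (-(z ^ (-(c : ℤ))) * tailSeries P (c + e₀) z) =
      (∑ i ∈ Finset.range r, a i * (z / (1 - z) ^ 2) ^ (e₀ + i)) * ((1 + z) / (1 - z)) := by
  set β : ℝ[X] := C M * P.comp (-X - C (c : ℝ)) with hβdef
  have hβ : ∀ x, β.eval x = M * P.eval (-c - x) := fun x => by
    simp only [hβdef, eval_mul, eval_C, eval_comp, eval_sub, eval_neg, eval_X]
    ring_nf
  have hβ0 : ∀ w : ℕ, w < e₀ → β.eval (w : ℝ) = 0 := fun w hw => by rw [hβ, hzero w hw, mul_zero]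
  obtain ⟨a, ha⟩ := exists_int_combination_even (β := β) he₀
    (hd.trans' (Nat.add_le_add_right (natDegree_recentred M c) 2))
    (fun x => by rw [hβ, hβ, ← hpar]; ring_nf) hβ0 (fun w => by
      obtain ⟨l, hl⟩ := hint (-c - w)
      exact ⟨l, by rw [hβ, ← hl]; push_cast; ring⟩)
  refine ⟨fun i => -a i, ?_⟩
  rw [tailSeries_eq_of_hasSum hz0 hβ hβ0
    (hasSum_combination he₀ (fun e he => hasSum_evenBasis he hz) ha), Finset.sum_mul,
    ← Finset.sum_neg_distrib]
  refine Finset.sum_congr rfl fun i _ => ?_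
  push_cast; ring

/-! ### Values at `xk k` and clearing powers of k/2 -/

theorem xk_div_sq {k : ℕ} (hk : 1 ≤ k) : xk k / (1 - xk k) ^ 2 = k / 2 := by
  have hk0 : (k : ℝ) ≠ 0 := by exact_mod_cast (by omega : k ≠ 0)
  have h1 : 1 - xk k ≠ 0 := by have := (xk_mem_Ioo hk).2; linarith
  have hs : √(2 * (k : ℝ) + 1) ^ 2 = 2 * k + 1 := Real.sq_sqrt (by positivity)
  rw [div_eq_div_iff (pow_ne_zero 2 h1) two_ne_zero]
  unfold xk
  generalize √(2 * (k : ℝ) + 1) = s at hs ⊢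
  field_simp
  linear_combination (-1) * hs

theorem one_add_xk_div {k : ℕ} (hk : 1 ≤ k) :
    (1 + xk k) / (1 - xk k) = √(2 * (k : ℝ) + 1) := by
  have hk0 : (k : ℝ) ≠ 0 := by exact_mod_cast (by omega : k ≠ 0)
  have h1 : 1 - xk k ≠ 0 := by have := (xk_mem_Ioo hk).2; linarith
  have hs : √(2 * (k : ℝ) + 1) ^ 2 = 2 * k + 1 := Real.sq_sqrt (by positivity)
  rw [div_eq_iff h1]
  unfold xk
  generalize √(2 * (k : ℝ) + 1) = s at hs ⊢
  field_simp
  linear_combination (-1) * hs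

/-- For even k the base k/2 is already an integer, so only `h₁` matters. For odd k the power of 2 in
`factor` must absorb 2^e, which is what `h₂` guarantees. -/
theorem factor_mul_pow_int {a b n k e₁ e : ℕ} (hk : 1 ≤ k) (h₁ : e₁ ≤ e)
    (h₂ : e ≤ (3 * (b - 2 * a) * n + 1) / 2) :
    ∃ m : ℤ, factor a b n k e₁ * ((k : ℝ) / 2) ^ e = m := by
  obtain ⟨f, rfl⟩ := Nat.exists_eq_add_of_le h₁
  unfold factor
  split_ifs with h
  · obtain ⟨m, rfl⟩ := h
    have hm : ((m : ℝ)) ≠ 0 := by exact_mod_cast (by omega : m ≠ 0)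
    refine ⟨(m : ℤ) ^ f, ?_⟩
    rw [(by omega : (m + m) / 2 = m), (by push_cast; ring : ((m + m : ℕ) : ℝ) / 2 = m), zpow_neg,
      zpow_natCast, pow_add]
    push_cast
    field_simp
  · have hk0 : (k : ℝ) ≠ 0 := by exact_mod_cast (by omega : k ≠ 0)
    obtain ⟨g, hg⟩ := Nat.exists_eq_add_of_le h₂
    refine ⟨(2 : ℤ) ^ g * (k : ℤ) ^ f, ?_⟩
    rw [hg, zpow_neg, zpow_natCast, div_pow, pow_add _ _ g, pow_add (k : ℝ)]
    push_cast
    field_simp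

theorem factor_mul_sum_int {a b n k e₁ e₀ r : ℕ} (hk : 1 ≤ k) (c : ℕ → ℤ) (h₁ : e₁ ≤ e₀)
    (h₂ : e₀ + r ≤ (3 * (b - 2 * a) * n + 1) / 2 + 1) :
    ∃ m : ℤ, factor a b n k e₁ * ∑ i ∈ Finset.range r, c i * ((k : ℝ) / 2) ^ (e₀ + i) = m := by
  have h : ∀ i, ∃ m : ℤ, i ∈ Finset.range r →
      factor a b n k e₁ * ((k : ℝ) / 2) ^ (e₀ + i) = m := fun i => by
    by_cases hi : i ∈ Finset.range r
    · rw [Finset.mem_range] at hi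
      obtain ⟨m, hm⟩ := factor_mul_pow_int (a := a) (b := b) (n := n) (e := e₀ + i) hk
        (h₁.trans (by omega)) (by omega)
      exact ⟨m, fun _ => hm⟩
    · exact ⟨0, fun h => absurd h hi⟩
  choose m hm using h
  refine ⟨∑ i ∈ Finset.range r, c i * m i, ?_⟩
  push_cast
  rw [Finset.mul_sum]
  refine Finset.sum_congr rfl fun i hi => ?_
  rw [← hm i hi]; ring

/-! ### Linear factors of A and their divisibility by prime powers -/

/-- The blocks of linear factors of `polyA` are `(shift j, shift j + len j]`. -/
def shift (a n : ℕ) : Fin 3 → ℕ := ![2 * a * n, a * n, 0]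

/-- The lengths of the blocks of linear factors of `polyA`. -/
def len (a b n : ℕ) : Fin 3 → ℕ := ![(b - 4 * a) * n, (b - 2 * a) * n, b * n]

/-- The index set of the linear factors of `polyA`. -/
def factors (a b n : ℕ) : Finset (Σ _ : Fin 3, ℕ) :=
  Finset.univ.sigma fun j => Finset.Icc (shift a n j + 1) (shift a n j + len a b n j)

theorem polyA_eq {a b : ℕ} (n : ℕ) (hab : 4 * a < b) :
    polyA a b n = C (1 / ((∏ j, (len a b n j).factorial : ℕ) : ℝ)) *
      ∏ x ∈ factors a b n, (X + C (x.2 : ℝ)) := by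
  have h0 : 2 * a * n + (b - 4 * a) * n = (b - 2 * a) * n := by
    rw [← add_mul]; congr 1; omega
  have h1 : a * n + (b - 2 * a) * n = (b - a) * n := by
    rw [← add_mul]; congr 1; omega
  rw [factors, Finset.prod_sigma, Fin.prod_univ_three, Fin.prod_univ_three]
  simp only [shift, len, Matrix.cons_val_zero, Matrix.cons_val_one, Matrix.cons_val_two,
    Matrix.head_cons, Matrix.tail_cons, h0, h1, zero_add]
  rw [polyA]
  push_cast
  simp only [one_div, mul_inv, C_mul]
  ring

theorem card_filter_dvd_block (m : ℤ) (s L : ℕ) {q : ℕ} (hq : 0 < q) :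
    (((Finset.Icc (s + 1) (s + L)).filter fun i : ℕ => (q : ℤ) ∣ m + (i : ℤ)).card : ℤ) =
      (m + s + L) / q - (m + s) / q := by
  have hq' : (0 : ℤ) < q := by exact_mod_cast hq
  have h := Int.Ioc_filter_dvd_card (m + s) (m + s + L) hq'
  have hle : (m + s) / (q : ℤ) ≤ (m + s + L) / q := Int.ediv_le_ediv hq' (by omega)
  have hfl : ∀ x : ℤ, ⌊(x : ℚ) / ((q : ℤ) : ℚ)⌋ = x / q := fun x => by
    rw [Int.cast_natCast]; exact Rat.floor_intCast_div_natCast x q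
  rw [hfl, hfl, max_eq_left (by omega)] at h
  rw [← h]
  congr 1
  refine Finset.card_nbij' (fun i => m + (i : ℤ)) (fun x => (x - m).toNat) ?_ ?_ ?_ ?_
  · intro i hi
    simp only [Finset.coe_filter, Finset.mem_Icc, Set.mem_ofPred_eq, Finset.mem_Ioc] at hi ⊢
    exact ⟨by omega, hi.2⟩
  · intro x hx
    simp only [Finset.coe_filter, Finset.mem_Icc, Set.mem_ofPred_eq, Finset.mem_Ioc] at hx ⊢
    refine ⟨by omega, ?_⟩
    rw [Int.toNat_of_nonneg (by omega), add_sub_cancel]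
    exact hx.2
  · intro i _
    simp
  · intro x hx
    simp only [Finset.coe_filter, Set.mem_ofPred_eq, Finset.mem_Ioc] at hx
    show m + (((x - m).toNat : ℕ) : ℤ) = x
    omega

theorem card_filter_dvd_factors (a b n : ℕ) (m : ℤ) {q : ℕ} (hq : 0 < q) :
    (((factors a b n).filter fun x => (q : ℤ) ∣ m + (x.2 : ℤ)).card : ℤ) =
      ∑ j, ((m + shift a n j + len a b n j) / q - (m + shift a n j) / q) := by
  rw [Finset.card_filter, factors, Finset.sum_sigma]
  push_cast
  refine Finset.sum_congr rfl fun j _ => ?_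
  rw [← card_filter_dvd_block m _ _ hq, Finset.card_filter]
  push_cast
  rfl

/-- Among L consecutive integers at least ⌊L/q⌋ are multiples of q; this is summed over the three
blocks. -/
theorem sum_len_div_le_card (a b n : ℕ) (m : ℤ) {q : ℕ} (hq : 0 < q) :
    ∑ j, len a b n j / q ≤ ((factors a b n).filter fun x => (q : ℤ) ∣ m + (x.2 : ℤ)).card := by
  have hq' : (0 : ℤ) < q := by exact_mod_cast hq
  zify
  rw [card_filter_dvd_factors a b n m hq]
  refine Finset.sum_le_sum fun j _ => ?_
  rw [le_sub_iff_add_le, Int.le_ediv_iff_mul_le hq', add_mul]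
  have h1 := Int.ediv_mul_le (len a b n j : ℤ) hq'.ne'
  have h2 := Int.ediv_mul_le (m + shift a n j) hq'.ne'
  linarith

theorem floor_sub_mul_fract (x t : ℝ) (c : ℤ) :
    ⌊x - c * Int.fract t⌋ = ⌊x - c * t⌋ + c * ⌊t⌋ := by
  rw [← Int.floor_add_intCast, Int.fract]
  push_cast
  ring_nf

/-- This is where Ω enters: its defining expression is exactly the number of multiples of p among
the factors minus the level-one Legendre count. -/
theorem sum_len_div_lt_card {a b n p : ℕ} (hab : 4 * a < b) (hp : 0 < p)
    (h : Int.fract ((n : ℝ) / p) ∈ Omega a b) (m : ℤ) :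
    ∑ j, len a b n j / p + 1 ≤
      ((factors a b n).filter fun x => (p : ℤ) ∣ m + (x.2 : ℤ)).card := by
  zify
  rw [card_filter_dvd_factors a b n m hp]
  obtain ⟨-, -, h⟩ := h
  -- With this x the arguments x - cy become block endpoints over p. Passing from {n/p} to n/p
  -- changes nothing, since the multiples of ⌊n/p⌋ cancel within each bracket.
  have h := h (((m + b * n : ℤ) : ℝ) / p)
  have hfl : ∀ z : ℤ, ⌊(z : ℝ) / (p : ℝ)⌋ = z / p := fun z => by
    have := Rat.floor_cast (α := ℝ) ((z : ℚ) / (p : ℚ))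
    push_cast at this
    rw [this, Rat.floor_intCast_div_natCast]
  have e1 : ∀ c : ℤ, ⌊((m + b * n : ℤ) : ℝ) / p - c * Int.fract ((n : ℝ) / p)⌋ =
      (m + b * n - c * n) / p + c * ⌊(n : ℝ) / p⌋ := fun c => by
    rw [floor_sub_mul_fract, ← hfl]
    push_cast
    ring_nf
  have e2 : ∀ c : ℤ, ⌊c * Int.fract ((n : ℝ) / p)⌋ = (c * n) / p - c * ⌊(n : ℝ) / p⌋ := fun c => by
    have := floor_sub_mul_fract 0 ((n : ℝ) / p) (-c)
    rw [← hfl]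
    push_cast at this ⊢
    ring_nf at this ⊢
    exact this
  have f1 := e1 (2 * a)
  have f2 := e1 (b - 2 * a)
  have f3 := e1 a
  have f4 := e1 (b - a)
  have f5 := e1 b
  have g1 := e2 (b - 4 * a)
  have g2 := e2 (b - 2 * a)
  have g3 := e2 b
  have f6 := hfl (m + b * n)
  push_cast at f1 f2 f3 f4 f5 f6 g1 g2 g3 h
  rw [f1, f2, f3, f4, f5, f6, g1, g2, g3] at h
  rw [Fin.sum_univ_three, Fin.sum_univ_three]
  simp only [shift, len, Matrix.cons_val_zero, Matrix.cons_val_one, Matrix.cons_val_two,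
    Matrix.head_cons, Matrix.tail_cons]
  push_cast [Nat.cast_sub (by omega : 4 * a ≤ b), Nat.cast_sub (by omega : 2 * a ≤ b)]
  ring_nf at h ⊢
  linarith

/-! ### Comparing valuations; the numbers d, Δ and Δ₁ -/

theorem card_filter_le_add {α : Type*} [DecidableEq α] (I R : Finset α) (P : α → Prop)
    [DecidablePred P] : (I.filter P).card ≤ (R.filter P).card + (I \ R).card := by
  rw [← Finset.card_union_add_card_inter (R.filter P)]
  refine (Finset.card_le_card ?_).trans (Nat.le_add_right _ _)
  intro x hx
  simp only [Finset.mem_filter, Finset.mem_union, Finset.mem_sdiff] at hx ⊢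
  tauto

/-- Level-by-level comparison of the `p`-adic valuations of a product of integers and of a
product of factorials. -/
theorem prod_factorial_dvd_mul_prod {ι κ : Type*} [Fintype ι] (L : ι → ℕ) (R : Finset κ)
    (f : κ → ℤ) {M : ℕ} (hM : M ≠ 0)
    (h : ∀ p : ℕ, p.Prime → ∃ μ : ℕ → ℕ,
      (∀ B, ∑ l ∈ Finset.Ico 1 B, μ l ≤ M.factorization p) ∧
      ∀ l, 1 ≤ l → ∑ j, L j / p ^ l ≤ (R.filter fun x => ((p ^ l : ℕ) : ℤ) ∣ f x).card + μ l) :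
    ((∏ j, (L j).factorial : ℕ) : ℤ) ∣ M * ∏ x ∈ R, f x := by
  by_cases h0 : ∃ x ∈ R, f x = 0
  · obtain ⟨x, hx, hfx⟩ := h0
    rw [Finset.prod_eq_zero hx hfx, mul_zero]
    exact dvd_zero _
  push Not at h0
  have hR : ∏ x ∈ R, (f x).natAbs ≠ 0 :=
    Finset.prod_ne_zero_iff.2 fun x hx => Int.natAbs_ne_zero.2 (h0 x hx)
  rw [Int.natCast_dvd, Int.natAbs_mul, Int.natAbs_natCast, ← Int.natAbsHom_apply, map_prod]
  simp only [Int.natAbsHom_apply]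
  rw [← Nat.factorization_prime_le_iff_dvd
    (Finset.prod_ne_zero_iff.2 fun j _ => Nat.factorial_ne_zero _) (mul_ne_zero hM hR)]
  intro p hp
  obtain ⟨μ, hμ, hl⟩ := h p hp
  obtain ⟨B, hB1, hB2⟩ : ∃ B, (∀ j, Nat.log p (L j) < B) ∧ ∀ x ∈ R, (f x).natAbs < p ^ B := by
    refine ⟨∑ j, L j + ∑ x ∈ R, (f x).natAbs + 1, fun j => ?_, fun x hx => ?_⟩
    · have h1 := Finset.single_le_sum (f := L) (fun _ _ => Nat.zero_le _) (Finset.mem_univ j)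
      have h2 := Nat.log_le_self p (L j)
      omega
    · have h1 := Finset.single_le_sum (f := fun x => (f x).natAbs) (fun _ _ => Nat.zero_le _) hx
      refine (Nat.lt_pow_self hp.one_lt).trans_le (Nat.pow_le_pow_right hp.pos ?_)
      omega
  rw [Nat.factorization_mul hM hR, Finsupp.add_apply,
    Nat.factorization_prod_apply (fun j _ => Nat.factorial_ne_zero _),
    Nat.factorization_prod_apply (fun x hx => Int.natAbs_ne_zero.2 (h0 x hx)),
    Finset.sum_congr rfl fun j _ => Nat.factorization_factorial hp (hB1 j), Finset.sum_comm,
    Finset.sum_congr rfl fun x hx => Nat.factorization_eq_card_pow_dvd_of_lt hp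
      (Int.natAbs_pos.2 (h0 x hx)) (hB2 x hx)]
  have hc : ∑ x ∈ R, ((Finset.Ico 1 B).filter fun l => p ^ l ∣ (f x).natAbs).card =
      ∑ l ∈ Finset.Ico 1 B, (R.filter fun x => ((p ^ l : ℕ) : ℤ) ∣ f x).card := by
    simp only [Finset.card_filter, Int.natCast_dvd]
    exact Finset.sum_comm
  rw [hc]
  calc ∑ l ∈ Finset.Ico 1 B, ∑ j, L j / p ^ l
      ≤ ∑ l ∈ Finset.Ico 1 B, ((R.filter fun x => ((p ^ l : ℕ) : ℤ) ∣ f x).card + μ l) :=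
        Finset.sum_le_sum fun l hl' => hl l (Finset.mem_Ico.1 hl').1
    _ ≤ _ := by
        rw [Finset.sum_add_distrib, add_comm]
        exact Nat.add_le_add_right (hμ B) _

theorem d_ne_zero (N : ℕ) : d N ≠ 0 := by
  rw [d, Ne, Finset.lcm_eq_zero_iff]
  simp

theorem dvd_d {i N : ℕ} (h1 : 1 ≤ i) (h2 : i ≤ N) : i ∣ d N :=
  Finset.dvd_lcm (f := id) (Finset.mem_Icc.2 ⟨h1, h2⟩)

/-- The lcm provides one factor p for each level l with p^l ≤ N, in the shape needed for the
allowance μ. -/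
theorem sum_ite_pow_le_factorization_d {p : ℕ} (hp : p.Prime) (N B : ℕ) :
    ∑ l ∈ Finset.Ico 1 B, (if p ^ l ≤ N then 1 else 0) ≤ (d N).factorization p := by
  have h1 : ∑ l ∈ Finset.Ico 1 B, (if p ^ l ≤ N then 1 else 0) ≤ Nat.log p N := by
    rw [← Finset.card_filter]
    calc _ ≤ (Finset.Icc 1 (Nat.log p N)).card := by
          refine Finset.card_le_card fun l hl => ?_
          rw [Finset.mem_filter, Finset.mem_Ico] at hl
          exact Finset.mem_Icc.2 ⟨hl.1.1, Nat.le_log_of_pow_le hp.one_lt hl.2⟩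
      _ = _ := by simp
  refine h1.trans ?_
  rcases Nat.eq_zero_or_pos N with rfl | hN
  · simp
  · exact (hp.pow_dvd_iff_le_factorization (d_ne_zero N)).1
      (dvd_d (Nat.one_le_pow _ _ hp.pos) (Nat.pow_log_le_self p hN.ne'))

theorem Delta_eq {a b : ℕ} (n : ℕ) (hab : 4 * a < b) :
    Delta a b n = ∏ p ∈ (finite_DeltaPrimes n hab).toFinset, p :=
  finprod_mem_eq_finite_toFinset_prod _ _

theorem Delta_dvd_d {a b : ℕ} (n : ℕ) (hab : 4 * a < b) : Delta a b n ∣ d (b * n) := by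
  rw [Delta_eq n hab]
  refine Finset.prod_primes_dvd _ (fun p hp => ?_) (fun p hp => ?_)
  · rw [Set.Finite.mem_toFinset] at hp
    exact hp.1.prime
  · rw [Set.Finite.mem_toFinset] at hp
    exact dvd_d hp.1.one_le (le_of_fract_mem_Omega hab hp.2.2)

theorem Delta_ne_zero {a b : ℕ} (n : ℕ) (hab : 4 * a < b) : Delta a b n ≠ 0 :=
  ne_zero_of_dvd_ne_zero (d_ne_zero _) (Delta_dvd_d n hab)

theorem mem_DeltaPrimes_of_dvd {a b n p : ℕ} (hab : 4 * a < b) (hp : p.Prime)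
    (h : p ∣ Delta a b n) : p ∈ DeltaPrimes a b n := by
  rw [Delta_eq n hab, hp.prime.dvd_finsetProd_iff] at h
  obtain ⟨q, hq, hpq⟩ := h
  rw [Set.Finite.mem_toFinset] at hq
  rwa [(Nat.prime_dvd_prime_iff_eq hp hq.1).1 hpq]

theorem Delta1_eq {a b : ℕ} (n : ℕ) (hab : 4 * a < b) :
    Delta1 a b n = ∏ p ∈ (finite_Delta1Primes n hab).toFinset, p :=
  finprod_mem_eq_finite_toFinset_prod _ _

theorem Delta1_ne_zero {a b : ℕ} (n : ℕ) (hab : 4 * a < b) : Delta1 a b n ≠ 0 := by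
  rw [Delta1_eq n hab, Finset.prod_ne_zero_iff]
  intro p hp
  rw [Set.Finite.mem_toFinset] at hp
  exact hp.1.ne_zero

theorem dvd_Delta1 {a b n p : ℕ} (hab : 4 * a < b) (hp : p ∈ Delta1Primes a b n) :
    p ∣ Delta1 a b n := by
  rw [Delta1_eq n hab]
  exact Finset.dvd_prod_of_mem _ ((Set.Finite.mem_toFinset _).2 hp)

/-- The integer `d_{bn} / Δ`. -/
noncomputable def quotD (a b n : ℕ) : ℕ := d (b * n) / Delta a b n

theorem quotD_mul {a b : ℕ} (n : ℕ) (hab : 4 * a < b) :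
    quotD a b n * Delta a b n = d (b * n) := Nat.div_mul_cancel (Delta_dvd_d n hab)

theorem quotD_ne_zero {a b : ℕ} (n : ℕ) (hab : 4 * a < b) : quotD a b n ≠ 0 := fun h =>
  d_ne_zero (b * n) (by rw [← quotD_mul n hab, h, zero_mul])

theorem cast_quotD {a b : ℕ} (n : ℕ) (hab : 4 * a < b) :
    (quotD a b n : ℝ) = (d (b * n) : ℝ) / (Delta a b n : ℝ) := by
  rw [← quotD_mul n hab, Nat.cast_mul, mul_div_cancel_right₀]
  exact_mod_cast Delta_ne_zero n hab

theorem factorization_quotD {a b n p : ℕ} (hab : 4 * a < b) (hp : p.Prime)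
    (h : p ∉ DeltaPrimes a b n) :
    (quotD a b n).factorization p = (d (b * n)).factorization p := by
  rw [← quotD_mul n hab, Nat.factorization_mul (quotD_ne_zero n hab) (Delta_ne_zero n hab),
    Finsupp.add_apply, Nat.factorization_eq_zero_of_not_dvd
      fun hd => h (mem_DeltaPrimes_of_dvd hab hp hd), add_zero]

/-- Above (b-2a)n only the factorial of bn still contributes, and at most once, because b > 4a gives
bn ≤ 2(b-2a)n < 2q. -/
theorem sum_len_div_le_two {a b n q : ℕ} (hab : 4 * a < b) (hq : (b - 2 * a) * n < q) :
    ∑ j, len a b n j / q ≤ if q ≤ b * n then 1 else 0 := by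
  have h0 : (b - 4 * a) * n ≤ (b - 2 * a) * n := Nat.mul_le_mul_right _ (by omega)
  have h1 : b * n ≤ 2 * ((b - 2 * a) * n) := by
    rw [← mul_assoc]; exact Nat.mul_le_mul_right _ (by omega)
  rw [Fin.sum_univ_three]
  simp only [len, Matrix.cons_val_zero, Matrix.cons_val_one, Matrix.cons_val]
  rw [Nat.div_eq_of_lt (h0.trans_lt hq), Nat.div_eq_of_lt hq]
  split_ifs with h
  · have : b * n / q < 2 := Nat.div_lt_of_lt_mul (by omega)
    omega
  · rw [Nat.div_eq_of_lt (by omega)]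

theorem sum_len_div_eq_zero {a b n q : ℕ} (hab : 4 * a < b) (hq : b * n < q) :
    ∑ j, len a b n j / q = 0 := by
  have h := sum_len_div_le_two hab ((Nat.mul_le_mul_right n (Nat.sub_le b (2 * a))).trans_lt hq)
  rw [if_neg (by omega)] at h
  omega

/-- The bound p > √(bn) in Δ serves to make level one the only relevant level. -/
theorem lt_pow_of_mem_DeltaPrimes {a b n p l : ℕ} (hp : p ∈ DeltaPrimes a b n) (hl : 2 ≤ l) :
    b * n < p ^ l := by
  have h := hp.2.1
  have hp0 : (0 : ℝ) < p := by exact_mod_cast hp.1.pos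
  rw [Real.sqrt_lt' hp0] at h
  have h' : b * n < p ^ 2 := by exact_mod_cast h
  exact h'.trans_le (Nat.pow_le_pow_right hp.1.pos hl)

theorem prod_factors_dvd (a b n : ℕ) (m : ℤ) :
    ((∏ j, (len a b n j).factorial : ℕ) : ℤ) ∣
      (1 : ℕ) * ∏ x ∈ factors a b n, (m + (x.2 : ℤ)) := by
  refine prod_factorial_dvd_mul_prod _ _ _ one_ne_zero fun p hp => ⟨0, by simp, fun l _ => ?_⟩
  exact sum_len_div_le_card a b n m (pow_pos hp.pos l)

/-- The deleted factor costs one at each level with p^l ≤ bn, paid by d_{bn}; higher levels do not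
occur in the factorials. For p in Δ the spare multiple from Ω covers the loss, so nothing is asked
of the multiplier. -/
theorem prod_factors_erase_dvd {a b : ℕ} (n : ℕ) (hab : 4 * a < b) (m : ℤ)
    {R : Finset (Σ _ : Fin 3, ℕ)} (hR : (factors a b n \ R).card ≤ 1) :
    ((∏ j, (len a b n j).factorial : ℕ) : ℤ) ∣ quotD a b n * ∏ x ∈ R, (m + (x.2 : ℤ)) := by
  refine prod_factorial_dvd_mul_prod _ _ _ (quotD_ne_zero n hab) fun p hp => ?_
  by_cases hΔ : p ∈ DeltaPrimes a b n
  · refine ⟨0, by simp, fun l hl => ?_⟩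
    rcases hl.eq_or_lt with rfl | hl
    · have h1 := sum_len_div_lt_card hab hp.pos hΔ.2.2 m
      have h2 := card_filter_le_add (factors a b n) R fun x => (p : ℤ) ∣ m + (x.2 : ℤ)
      simp only [pow_one, Pi.zero_apply]
      omega
    · rw [sum_len_div_eq_zero hab (lt_pow_of_mem_DeltaPrimes hΔ hl)]
      exact Nat.zero_le _
  · refine ⟨fun l => if p ^ l ≤ b * n then 1 else 0, fun B => ?_, fun l _ => ?_⟩
    · rw [factorization_quotD hab hp hΔ]
      exact sum_ite_pow_le_factorization_d hp _ _
    · beta_reduce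
      split_ifs with h
      · have h1 := sum_len_div_le_card a b n m (pow_pos hp.pos l)
        have h2 := card_filter_le_add (factors a b n) R
          fun x => ((p ^ l : ℕ) : ℤ) ∣ m + (x.2 : ℤ)
        omega
      · rw [sum_len_div_eq_zero hab (not_le.1 h)]
        exact Nat.zero_le _

/-- Two deletions cost at most two when p^l ≤ (b-2a)n, and only one when (b-2a)n < p^l ≤ bn, since
the count to be matched is then at most one. For p in Δ one unit remains due after using Ω:
d_{(b-2a)n} pays it if p ≤ (b-2a)n, and Δ₁ otherwise. -/
theorem prod_factors_erase_erase_dvd {a b : ℕ} (n : ℕ) (hab : 4 * a < b) (m : ℤ)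
    {R : Finset (Σ _ : Fin 3, ℕ)} (hR : (factors a b n \ R).card ≤ 2) :
    ((∏ j, (len a b n j).factorial : ℕ) : ℤ) ∣
      ((d ((b - 2 * a) * n) * Delta1 a b n * quotD a b n : ℕ) : ℤ) *
        ∏ x ∈ R, (m + (x.2 : ℤ)) := by
  have hd := d_ne_zero ((b - 2 * a) * n)
  have hD := Delta1_ne_zero n hab
  have hq := quotD_ne_zero n hab
  refine prod_factorial_dvd_mul_prod _ _ _ (mul_ne_zero (mul_ne_zero hd hD) hq) fun p hp => ?_
  by_cases hΔ : p ∈ DeltaPrimes a b n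
  · refine ⟨fun l => if l = 1 then 1 else 0, fun B => ?_, fun l hl => ?_⟩
    · have h1 : p ∣ d ((b - 2 * a) * n) * Delta1 a b n * quotD a b n := by
        refine Dvd.dvd.mul_right ?_ _
        by_cases h : p ≤ (b - 2 * a) * n
        · exact (dvd_d hp.one_le h).mul_right _
        · exact (dvd_Delta1 hab ⟨hp, not_le.1 h, hΔ.2.2⟩).mul_left _
      have h2 := (hp.dvd_iff_one_le_factorization (mul_ne_zero (mul_ne_zero hd hD) hq)).1 h1
      refine le_trans ?_ h2
      rw [Finset.sum_ite_eq']
      split_ifs <;> omega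
    · rcases hl.eq_or_lt with rfl | hl
      · have h1 := sum_len_div_lt_card hab hp.pos hΔ.2.2 m
        have h2 := card_filter_le_add (factors a b n) R fun x => (p : ℤ) ∣ m + (x.2 : ℤ)
        simp only [pow_one, if_true]
        omega
      · rw [sum_len_div_eq_zero hab (lt_pow_of_mem_DeltaPrimes hΔ hl)]
        exact Nat.zero_le _
  · refine ⟨fun l => (if p ^ l ≤ (b - 2 * a) * n then 1 else 0) +
      (if p ^ l ≤ b * n then 1 else 0), fun B => ?_, fun l _ => ?_⟩
    · rw [Finset.sum_add_distrib, Nat.factorization_mul (mul_ne_zero hd hD) hq,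
        Nat.factorization_mul hd hD, Finsupp.add_apply, Finsupp.add_apply,
        factorization_quotD hab hp hΔ]
      have h1 := sum_ite_pow_le_factorization_d hp ((b - 2 * a) * n) B
      have h2 := sum_ite_pow_le_factorization_d hp (b * n) B
      omega
    · beta_reduce
      by_cases h : p ^ l ≤ (b - 2 * a) * n
      · have h1 := sum_len_div_le_card a b n m (pow_pos hp.pos l)
        have h2 := card_filter_le_add (factors a b n) R
          fun x => ((p ^ l : ℕ) : ℤ) ∣ m + (x.2 : ℤ)
        have h3 : p ^ l ≤ b * n := h.trans (Nat.mul_le_mul_right n (Nat.sub_le b (2 * a)))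
        rw [if_pos h, if_pos h3]
        omega
      · have h1 := sum_len_div_le_two hab (not_le.1 h)
        rw [if_neg h, zero_add]
        exact h1.trans (Nat.le_add_left _ _)

/-! ### Integrality of A, A', A'' at integers -/

theorem exists_int_of_dvd {G M : ℕ} (hG : G ≠ 0) {κ : Type*} (s : Finset κ) (F : κ → ℤ)
    (h : ∀ x ∈ s, (G : ℤ) ∣ M * F x) :
    ∃ l : ℤ, (M : ℝ) * (1 / (G : ℝ) * ∑ x ∈ s, (F x : ℝ)) = l := by
  have h' : (G : ℤ) ∣ ∑ x ∈ s, M * F x := Finset.dvd_sum h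
  obtain ⟨l, hl⟩ := h'
  refine ⟨l, ?_⟩
  have hG' : (G : ℝ) ≠ 0 := by exact_mod_cast hG
  have := congrArg (Int.cast (R := ℝ)) hl
  push_cast at this
  rw [← Finset.mul_sum] at this
  field_simp
  linarith

theorem prod_len_factorial_ne_zero (a b n : ℕ) : ∏ j, (len a b n j).factorial ≠ 0 :=
  Finset.prod_ne_zero_iff.2 fun _ _ => Nat.factorial_ne_zero _

theorem polyA_int {a b : ℕ} (n : ℕ) (hab : 4 * a < b) (m : ℤ) :
    ∃ l : ℤ, 1 * (polyA a b n).eval (m : ℝ) = l := by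
  obtain ⟨l, hl⟩ := exists_int_of_dvd (M := 1) (prod_len_factorial_ne_zero a b n)
    (Finset.univ : Finset Unit) (fun _ => ∏ x ∈ factors a b n, (m + (x.2 : ℤ)))
    fun _ _ => prod_factors_dvd a b n m
  refine ⟨l, hl ▸ ?_⟩
  rw [polyA_eq n hab]
  simp [eval_prod]

theorem derivative_polyA_int {a b : ℕ} (n : ℕ) (hab : 4 * a < b) (m : ℤ) :
    ∃ l : ℤ, (quotD a b n : ℝ) * (derivative (polyA a b n)).eval (m : ℝ) = l := by
  obtain ⟨l, hl⟩ := exists_int_of_dvd (M := quotD a b n) (prod_len_factorial_ne_zero a b n)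
    (factors a b n) (fun y => ∏ x ∈ (factors a b n).erase y, (m + (x.2 : ℤ)))
    fun y hy => prod_factors_erase_dvd n hab m (by rw [Finset.sdiff_erase_self hy]; simp)
  refine ⟨l, hl ▸ ?_⟩
  rw [polyA_eq n hab, derivative_C_mul, derivative_prod_finset]
  simp [eval_prod, eval_finsetSum]

theorem derivative_derivative_polyA_int {a b : ℕ} (n : ℕ) (hab : 4 * a < b) (m : ℤ) :
    ∃ l : ℤ, ((d ((b - 2 * a) * n) * Delta1 a b n * quotD a b n : ℕ) : ℝ) *
      (derivative (derivative (polyA a b n))).eval (m : ℝ) = l := by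
  obtain ⟨l, hl⟩ := exists_int_of_dvd (M := d ((b - 2 * a) * n) * Delta1 a b n * quotD a b n)
    (prod_len_factorial_ne_zero a b n)
    -- By the product rule A'' is a sum over ordered pairs of distinct factor indices.
    ((factors a b n).sigma fun y => (factors a b n).erase y)
    (fun y => ∏ x ∈ ((factors a b n).erase y.1).erase y.2, (m + (x.2 : ℤ)))
    fun y _ => prod_factors_erase_erase_dvd n hab m (by
      have h : factors a b n \ ((factors a b n).erase y.1).erase y.2 ⊆ {y.1, y.2} := by
        intro x hx
        simp only [Finset.mem_sdiff, Finset.mem_erase, Finset.mem_insert,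
          Finset.mem_singleton] at hx ⊢
        tauto
      exact (Finset.card_le_card h).trans Finset.card_le_two)
  refine ⟨l, hl ▸ ?_⟩
  rw [polyA_eq n hab, derivative_C_mul, derivative_C_mul, derivative_prod_finset,
    Finset.sum_sigma]
  simp [eval_prod, eval_finsetSum, derivative_prod_finset]

/-! ### Degree, symmetry and zeros of A and its derivatives -/

theorem natDegree_polyA {a b : ℕ} (n : ℕ) (hab : 4 * a < b) :
    (polyA a b n).natDegree ≤ 3 * (b - 2 * a) * n := by
  rw [polyA_eq n hab]
  refine (natDegree_C_mul_le _ _).trans ((natDegree_prod_le _ _).trans ?_)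
  simp only [natDegree_X_add_C, Finset.sum_const, smul_eq_mul, mul_one]
  rw [factors, Finset.card_sigma, Fin.sum_univ_three]
  simp only [shift, len, Matrix.cons_val_zero, Matrix.cons_val_one, Matrix.cons_val_two,
    Matrix.head_cons, Matrix.tail_cons, Nat.card_Icc]
  have h : b - 4 * a + (b - 2 * a) + b = 3 * (b - 2 * a) := by omega
  rw [← h, add_mul, add_mul]
  omega

theorem prod_block_reflect (s L : ℕ) (x : ℝ) :
    ∏ i ∈ Finset.Icc (s + 1) (s + L), (-(2 * s + L + 1 : ℝ) - x + i) =
      (-1) ^ L * ∏ i ∈ Finset.Icc (s + 1) (s + L), (x + i) := by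
  have h1 : ∏ i ∈ Finset.Icc (s + 1) (s + L), (-(2 * s + L + 1 : ℝ) - x + i) =
      ∏ i ∈ Finset.Icc (s + 1) (s + L), (-(x + i)) := by
    -- Reversing the order of the block.
    refine Finset.prod_nbij' (fun i => 2 * s + L + 1 - i) (fun i => 2 * s + L + 1 - i) ?_ ?_ ?_ ?_ ?_
    · intro i hi; rw [Finset.mem_Icc] at hi ⊢; omega
    · intro i hi; rw [Finset.mem_Icc] at hi ⊢; omega
    · intro i hi; rw [Finset.mem_Icc] at hi; omega
    · intro i hi; rw [Finset.mem_Icc] at hi; omega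
    · intro i hi
      rw [Finset.mem_Icc] at hi
      rw [Nat.cast_sub (by omega)]
      push_cast
      ring
  rw [h1, Finset.prod_neg]
  simp

theorem polyA_reflect {a b n : ℕ} (hab : 4 * a < b) (hb : Odd b) (hn : Odd n) (x : ℝ) :
    (polyA a b n).eval (-((b * n : ℕ) + 1 : ℝ) - x) = -(polyA a b n).eval x := by
  -- The common centre of the blocks. It also makes every length odd, so the reflection yields three
  -- signs -1.
  have hs : ∀ j, 2 * shift a n j + len a b n j = b * n := by
    have e1 : 2 * (2 * a * n) + (b - 4 * a) * n = b * n := by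
      rw [← mul_assoc, ← add_mul]; congr 1; omega
    have e2 : 2 * (a * n) + (b - 2 * a) * n = b * n := by
      rw [← mul_assoc, ← add_mul]; congr 1; omega
    intro j
    fin_cases j <;> simp [shift, len, e1, e2]
  have hodd : ∀ j, (-1 : ℝ) ^ len a b n j = -1 := fun j => by
    have h1 : Odd (2 * shift a n j + len a b n j) := hs j ▸ hb.mul hn
    exact ((Nat.odd_add'.1 h1).2 (even_two_mul _)).neg_one_pow
  have key : ∀ j, ∏ i ∈ Finset.Icc (shift a n j + 1) (shift a n j + len a b n j),
      (-((b * n : ℕ) + 1 : ℝ) - x + i) =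
      -∏ i ∈ Finset.Icc (shift a n j + 1) (shift a n j + len a b n j), (x + i) := fun j => by
    rw [← neg_one_mul (∏ i ∈ _, _), ← hodd j, ← prod_block_reflect, ← hs j]
    push_cast
    rfl
  rw [polyA_eq n hab, factors, Finset.prod_sigma]
  simp only [eval_mul, eval_C, eval_prod, eval_add, eval_X]
  rw [Finset.prod_congr rfl fun j _ => key j, Finset.prod_neg, Finset.card_univ, Fintype.card_fin]
  ring

theorem eval_derivative_reflect {P : ℝ[X]} {t ε : ℝ}
    (h : ∀ x, P.eval (-t - x) = ε * P.eval x) (x : ℝ) :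
    (derivative P).eval (-t - x) = -ε * (derivative P).eval x := by
  have h1 : P.comp (C (-t) - X) = C ε * P := Polynomial.funext fun x => by
    simp only [eval_comp, eval_sub, eval_C, eval_X, eval_mul, h]
  have h2 := congrArg (fun Q => (derivative Q).eval x) h1
  simp only [derivative_comp, derivative_sub, derivative_C, derivative_X, eval_mul, eval_comp,
    eval_sub, eval_C, eval_X, eval_zero, eval_one, derivative_C_mul] at h2
  linarith

theorem X_add_C_dvd_block {G : ℝ} {s t j : ℕ} (h : j ∈ Finset.Icc s t) :
    (X + C (j : ℝ)) ∣ C G * ∏ i ∈ Finset.Icc s t, (X + C (i : ℝ)) :=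
  (Finset.dvd_prod_of_mem (fun i : ℕ => X + C (i : ℝ)) h).mul_left _

theorem eval_eq_zero_of_X_add_C_dvd {P : ℝ[X]} {r : ℝ} (h : (X + C r) ∣ P) : P.eval (-r) = 0 := by
  obtain ⟨Q, rfl⟩ := h
  simp

theorem polyA_eval_eq_zero {a b n j : ℕ} (h1 : 1 ≤ j) (h2 : j ≤ b * n) :
    (polyA a b n).eval (-(j : ℝ)) = 0 :=
  eval_eq_zero_of_X_add_C_dvd ((X_add_C_dvd_block (Finset.mem_Icc.2 ⟨h1, h2⟩)).mul_left _)

/-- On this range the second and third blocks overlap, so A has at least a double zero. -/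
theorem derivative_polyA_eval_eq_zero {a b n j : ℕ} (h1 : a * n + 1 ≤ j) (h2 : j ≤ (b - a) * n) :
    (derivative (polyA a b n)).eval (-(j : ℝ)) = 0 := by
  have h3 : j ≤ b * n := h2.trans (Nat.mul_le_mul_right _ (Nat.sub_le _ _))
  have h : (X + C (j : ℝ)) ^ 2 ∣ polyA a b n := by
    rw [sq]
    exact mul_dvd_mul ((X_add_C_dvd_block (Finset.mem_Icc.2 ⟨h1, h2⟩)).mul_left _)
      (X_add_C_dvd_block (Finset.mem_Icc.2 ⟨by omega, h3⟩))
  refine eval_eq_zero_of_X_add_C_dvd ?_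
  simpa using pow_sub_one_dvd_derivative_of_pow_dvd h

theorem derivative_derivative_polyA_eval_eq_zero {a b n j : ℕ} (h1 : 2 * a * n + 1 ≤ j)
    (h2 : j ≤ (b - 2 * a) * n) :
    (derivative (derivative (polyA a b n))).eval (-(j : ℝ)) = 0 := by
  have h3 : j ≤ b * n := h2.trans (Nat.mul_le_mul_right _ (Nat.sub_le _ _))
  have h4 : j ≤ (b - a) * n := h2.trans (Nat.mul_le_mul_right _ (by omega))
  have h5 : a * n + 1 ≤ j := by rw [mul_assoc] at h1; omega
  have h : (X + C (j : ℝ)) ^ 3 ∣ polyA a b n := by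
    rw [pow_succ, sq]
    exact mul_dvd_mul (mul_dvd_mul (X_add_C_dvd_block (Finset.mem_Icc.2 ⟨h1, h2⟩))
      (X_add_C_dvd_block (Finset.mem_Icc.2 ⟨h5, h4⟩)))
      (X_add_C_dvd_block (Finset.mem_Icc.2 ⟨by omega, h3⟩))
  refine eval_eq_zero_of_X_add_C_dvd ?_
  simpa using pow_sub_one_dvd_derivative_of_pow_dvd (pow_sub_one_dvd_derivative_of_pow_dvd h)

/-! ### Integrality of the multiplied series at `xk k` -/

section Integrality

variable {a b n k : ℕ}

theorem two_mul_half_add_one (hb : Odd b) (hn : Odd n) :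
    2 * ((b * n + 1) / 2) = b * n + 1 :=
  Nat.mul_div_cancel' (hb.mul hn).add_one.two_dvd

theorem two_mul_half_add_one_cast (hb : Odd b) (hn : Odd n) :
    2 * (((b * n + 1) / 2 : ℕ) : ℝ) = (b * n : ℕ) + 1 := by
  exact_mod_cast two_mul_half_add_one hb hn

theorem half_degree (hab : 4 * a < b) (hb : Odd b) (hn : Odd n) :
    2 * ((3 * (b - 2 * a) * n + 1) / 2) = 3 * (b - 2 * a) * n + 1 := by
  refine Nat.mul_div_cancel' (Odd.add_one ?_).two_dvd
  have h1 : Odd (b - 2 * a) := Nat.Odd.sub_even (by omega) hb (even_two_mul a)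
  exact ((by decide : Odd 3).mul h1).mul hn

theorem half_le_half_degree (hab : 4 * a < b) :
    (b * n + 1) / 2 ≤ (3 * (b - 2 * a) * n + 1) / 2 :=
  Nat.div_le_div_right (Nat.add_le_add_right (Nat.mul_le_mul_right _ (by omega)) 1)

theorem neg_sub_cast (c w : ℕ) : -(c : ℝ) - w = -((c + w : ℕ) : ℝ) := by
  push_cast; ring

/-- The exponent e is left free because U occurs with R, S and T; a smaller exponent divides out
fewer powers of k. -/
theorem factor_mul_U_int (hab : 4 * a < b) (hb : Odd b) (hn : Odd n) (hk : 1 ≤ k) {e : ℕ}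
    (he : e ≤ (b * n + 1) / 2) :
    ∃ m : ℤ, factor a b n k e * U a b n (xk k) = m := by
  have hx := xk_mem_Ioo hk
  have hc := two_mul_half_add_one hb hn
  have hc' := two_mul_half_add_one_cast hb hn
  have hK := half_degree hab hb hn
  have hcK := half_le_half_degree (n := n) hab
  have hbn : 1 ≤ b * n := (hb.mul hn).pos
  rw [U]
  generalize (b * n + 1) / 2 = c at *
  generalize hKe : (3 * (b - 2 * a) * n + 1) / 2 = K at *
  -- The exponents run from c to K, where 2K = 3(b-2a)n + 1 exceeds the degree bound by one.
  obtain ⟨r, hr⟩ : ∃ r, c + r = K + 1 := ⟨K + 1 - c, by omega⟩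
  have hdeg := natDegree_polyA n hab
  obtain ⟨u, hu⟩ := tailSeries_odd (P := polyA a b n) (M := 1) (c := c) (e₀ := c) (r := r)
    hx.1.ne' (by rw [abs_of_pos hx.1]; exact hx.2) (by omega) (by omega)
    (fun x => by rw [hc', polyA_reflect hab hb hn])
    (fun w hw => by
      rw [neg_sub_cast]
      exact polyA_eval_eq_zero (by omega) (by omega))
    (polyA_int n hab)
  rw [one_mul, (by omega : c + c = b * n + 1), xk_div_sq hk] at hu
  rw [hu]
  exact factor_mul_sum_int hk u he (by omega)

theorem factor_mul_V_int (hab : 4 * a < b) (hb : Odd b) (hn : Odd n) (hk : 1 ≤ k) {e : ℕ}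
    (he : e + a * n ≤ (b * n + 1) / 2) :
    ∃ m : ℤ, factor a b n k e * quotD a b n * V a b n (xk k) * √(2 * (k : ℝ) + 1) = m := by
  have hx := xk_mem_Ioo hk
  have hc := two_mul_half_add_one hb hn
  have hc' := two_mul_half_add_one_cast hb hn
  have hK := half_degree hab hb hn
  have hcK := half_le_half_degree (n := n) hab
  have h2 : (b - a) * n + a * n = b * n := by rw [← add_mul]; congr 1; omega
  have h3 : 4 * (a * n) + 1 ≤ b * n := by
    rw [← mul_assoc]; exact Nat.mul_lt_mul_of_pos_right hab hn.pos
  rw [V]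
  generalize (b * n + 1) / 2 = c at *
  generalize hKe : (3 * (b - 2 * a) * n + 1) / 2 = K at *
  obtain ⟨e₀, rfl⟩ : ∃ e₀, c = e₀ + a * n := ⟨c - a * n, by omega⟩
  obtain ⟨r, hr⟩ : ∃ r, e₀ + r = K + 1 := ⟨K + 1 - e₀, by omega⟩
  have hdeg := natDegree_polyA n hab
  have hdeg' := natDegree_derivative_le (polyA a b n)
  obtain ⟨u, hu⟩ := tailSeries_even (P := derivative (polyA a b n)) (M := quotD a b n)
    (c := e₀ + a * n) (e₀ := e₀) (r := r)
    hx.1.ne' (by rw [abs_of_pos hx.1]; exact hx.2) (by omega) (by omega)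
    (fun x => by
      rw [hc', eval_derivative_reflect (ε := -1)
        fun y => by rw [polyA_reflect hab hb hn, neg_one_mul]]
      ring)
    (fun w hw => by
      rw [neg_sub_cast]
      exact derivative_polyA_eval_eq_zero (by omega) (by omega))
    (derivative_polyA_int n hab)
  rw [(by omega : e₀ + a * n + e₀ = (b - a) * n + 1), xk_div_sq hk, one_add_xk_div hk] at hu
  obtain ⟨m, hm⟩ := factor_mul_sum_int (a := a) (b := b) (n := n) (e₁ := e) (e₀ := e₀) (r := r)
    hk u (by omega) (by omega)
  -- V itself carries one √(2k+1) from the even generating functions; the second one makes the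
  -- product rational.
  refine ⟨m * (2 * k + 1), ?_⟩
  have hs : √(2 * (k : ℝ) + 1) * √(2 * (k : ℝ) + 1) = 2 * k + 1 :=
    Real.mul_self_sqrt (by positivity)
  rw [mul_assoc (factor a b n k e), hu]
  push_cast
  rw [← hm]
  linear_combination (factor a b n k e * ∑ i ∈ Finset.range r, u i * ((k : ℝ) / 2) ^ (e₀ + i)) * hs

theorem factor_mul_W_int (hab : 4 * a < b) (hb : Odd b) (hn : Odd n) (hk : 1 ≤ k) {e : ℕ}
    (he : e + 2 * (a * n) ≤ (b * n + 1) / 2) :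
    ∃ m : ℤ, factor a b n k e * (d ((b - 2 * a) * n) : ℝ) * (Delta1 a b n : ℝ) * quotD a b n *
      W a b n (xk k) = m := by
  have hx := xk_mem_Ioo hk
  have hc := two_mul_half_add_one hb hn
  have hc' := two_mul_half_add_one_cast hb hn
  have hK := half_degree hab hb hn
  have hcK := half_le_half_degree (n := n) hab
  have h2 : (b - 2 * a) * n + 2 * (a * n) = b * n := by
    rw [← mul_assoc, ← add_mul]; congr 1; omega
  have h3 : 4 * (a * n) + 1 ≤ b * n := by
    rw [← mul_assoc]; exact Nat.mul_lt_mul_of_pos_right hab hn.pos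
  rw [W]
  generalize (b * n + 1) / 2 = c at *
  generalize hKe : (3 * (b - 2 * a) * n + 1) / 2 = K at *
  obtain ⟨e₀, rfl⟩ : ∃ e₀, c = e₀ + 2 * (a * n) := ⟨c - 2 * (a * n), by omega⟩
  obtain ⟨r, hr⟩ : ∃ r, e₀ + r = K + 1 := ⟨K + 1 - e₀, by omega⟩
  have hdeg := natDegree_polyA n hab
  have hdeg' := natDegree_derivative_le (polyA a b n)
  have hdeg'' := natDegree_derivative_le (derivative (polyA a b n))
  obtain ⟨u, hu⟩ := tailSeries_odd (P := derivative (derivative (polyA a b n)))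
    (M := (d ((b - 2 * a) * n) * Delta1 a b n * quotD a b n : ℕ))
    (c := e₀ + 2 * (a * n)) (e₀ := e₀) (r := r)
    hx.1.ne' (by rw [abs_of_pos hx.1]; exact hx.2) (by omega) (by omega)
    (fun x => by
      rw [hc', eval_derivative_reflect (ε := 1) fun y => by
        rw [eval_derivative_reflect (ε := -1)
          fun y => by rw [polyA_reflect hab hb hn, neg_one_mul], neg_neg]]
      ring)
    (fun w hw => by
      rw [neg_sub_cast]
      exact derivative_derivative_polyA_eval_eq_zero (by rw [mul_assoc]; omega) (by omega))
    (derivative_derivative_polyA_int n hab)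
  rw [(by omega : e₀ + 2 * (a * n) + e₀ = (b - 2 * a) * n + 1), xk_div_sq hk] at hu
  obtain ⟨m, hm⟩ := factor_mul_sum_int (a := a) (b := b) (n := n) (e₁ := e) (e₀ := e₀) (r := r)
    hk u (by omega) (by omega)
  refine ⟨m, ?_⟩
  rw [← hm, ← hu]
  push_cast
  ring

end Integrality

end LogForms

theorem lemma2 (a b n k : ℕ) (ha : 0 < a) (hab : 4 * a < b) (hb : Odd b) (hn : Odd n)
    (hk : 1 ≤ k) :
    ((∃ m : ℤ, LogForms.R a b n k * LogForms.U a b n (LogForms.xk k) = m) ∧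
      (∃ m : ℤ, LogForms.S a b n k *
          ((LogForms.d (b * n) : ℝ) / (LogForms.Delta a b n : ℝ)) *
          LogForms.V a b n (LogForms.xk k) * √(2 * (k : ℝ) + 1) = m) ∧
      (∃ m : ℤ, LogForms.T a b n k * (LogForms.d ((b - 2 * a) * n) : ℝ) *
          (LogForms.Delta1 a b n : ℝ) *
          ((LogForms.d (b * n) : ℝ) / (LogForms.Delta a b n : ℝ)) *
          LogForms.W a b n (LogForms.xk k) = m)) ∧
    ((∃ m : ℤ, LogForms.coeffP a b n k = m) ∧
      (∃ m : ℤ, LogForms.coeffQ a b n k = m) ∧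
      (∃ m : ℤ, LogForms.coeffX a b n k = m) ∧
      (∃ m : ℤ, LogForms.coeffY a b n k = m) ∧
      (∃ m : ℤ, LogForms.coeffZ a b n k = m)) := by
  have h2 : (b - 2 * a) * n + 2 * (a * n) = b * n := by
    rw [← mul_assoc, ← add_mul]; congr 1; omega
  have h4 : (b - 4 * a) * n + 4 * (a * n) = b * n := by
    rw [← mul_assoc, ← add_mul]; congr 1; omega
  -- The coefficients P, X and Y pair U and V with exponents below the sharp ones, so these integers
  -- are needed in addition to the three main claims.
  obtain ⟨sU, hsU⟩ := LogForms.factor_mul_U_int (a := a) (k := k)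
    (e := ((b - 2 * a) * n + 1) / 2) hab hb hn hk (by omega)
  obtain ⟨tU, htU⟩ := LogForms.factor_mul_U_int (a := a) (k := k)
    (e := ((b - 4 * a) * n + 1) / 2) hab hb hn hk (by omega)
  obtain ⟨sV, hsV⟩ := LogForms.factor_mul_V_int (a := a) (k := k)
    (e := ((b - 2 * a) * n + 1) / 2) hab hb hn hk (by omega)
  obtain ⟨tV, htV⟩ := LogForms.factor_mul_V_int (a := a) (k := k)
    (e := ((b - 4 * a) * n + 1) / 2) hab hb hn hk (by omega)
  obtain ⟨tW, htW⟩ := LogForms.factor_mul_W_int (a := a) (k := k)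
    (e := ((b - 4 * a) * n + 1) / 2) hab hb hn hk (by omega)
  simp only [LogForms.coeffP, LogForms.coeffQ, LogForms.coeffX, LogForms.coeffY, LogForms.coeffZ,
    LogForms.multS, LogForms.multT, LogForms.R, LogForms.S, LogForms.T,
    ← LogForms.cast_quotD n hab]
  refine ⟨⟨LogForms.factor_mul_U_int hab hb hn hk le_rfl, ⟨sV, hsV⟩, ⟨tW, htW⟩⟩,
    ⟨LogForms.quotD a b n * sU, ?_⟩, ⟨-sV, ?_⟩,
    ⟨LogForms.d ((b - 2 * a) * n) * LogForms.Delta1 a b n * LogForms.quotD a b n * tU, ?_⟩,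
    ⟨-(LogForms.d ((b - 2 * a) * n) * LogForms.Delta1 a b n * tV), ?_⟩,
    ⟨-((2 * k + 1) * tW), ?_⟩⟩
  · push_cast; rw [← hsU]; ring
  · push_cast; rw [← hsV]
  · push_cast; rw [← htU]; ring
  · push_cast; rw [← htV]; ring
  · push_cast; rw [← htW]; ring
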